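/- A (real) Banach lattice $X$ has a *strictly monotone* norm if $0\le x\le y$ and $x\ne y$ imply $\|x\|<\|y\|$. For $1<r<\infty$ and $x,y\in X$, put $$(|x|^r+|y|^r)^{1/r}=\sup\{a|x|+b|y| : a,b\ge 0,\ a^{r'}+b^{r'}\le 1\},\qquad r'=\tfrac{r}{r-1}$$ (this supremum always exists in $X$). $X$ is *exactly $r$-convex* if it is $r$-convex with constant one, i.e. $\|(|x|^r+|y|^r)^{1/r}\|\le(\|x\|^r+\|y\|^r)^{1/r}$ for all $x,y\in X$. A complex Banach lattice is the complexification $X_{\mathbb C}=X+iX$ of a real Banach lattice $X$, with modulus $|a+ib|=\sup_\theta\,\big((\cos\theta)a+(\sin\theta)b\big)\in X$ and norm $\|z\|=\|\,|z|\,\|$; it is called exactly $r$-convex, or strictly monotone, if $X$ is. Elements $x,y$ of a real or complex Banach lattice are *disjoint* if $|x|\wedge|y|=0$. Proposition. Let $r>2$ be a real number. (1) Let $X$ be a strictly monotone, exactly $r$-convex (real or complex) Banach lattice. Then two elements $x,y\in X$ are disjoint if and only if $$\|x+ty\|^r+\|x-ty\|^r\le 2\big(\|x\|^r+t^r\|y\|^r\big)\quad\text{for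 all } t\in[0,1].$$ (2) Consequently, let $X$ and $Y$ be exactly $r$-convex Banach lattices, both real or both complex, and assume that $Y$ has a strictly monotone norm. Then every (not necessarily surjective) linear isometry $T:X\to Y$ preserves disjointness: if $x,y\in X$ are disjoint, so are $Tx,Ty$. -/

import Mathlib

namespace BanachLattice

/-- The least upper bound of a set, where it exists (and `0` otherwise). -/
noncomputable def lub {X : Type*} [Lattice X] [Zero X] (S : Set X) : X :=
  open Classical in if h : ∃ z, IsLUB S z then h.choose else 0

theorem isLUB_lub {X : Type*} [Lattice X] [Zero X] {S : Set X} (h : ∃ z, IsLUB S z) :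
    IsLUB S (lub S) := by
  unfold lub
  rw [dif_pos h]
  exact h.choose_spec

section

variable {X : Type*} [NormedAddCommGroup X] [Lattice X] [IsOrderedAddMonoid X]
  [HasSolidNorm X] [NormedSpace ℝ X] [IsOrderedModule ℝ X]

/-- In a Banach lattice, a family of linear combinations of two fixed vectors, with coefficients in
a compact set, has a least upper bound. -/
theorem exists_isLUB_image [CompleteSpace X] {K : Set (ℝ × ℝ)} (hK : IsCompact K)
    (hne : K.Nonempty) (p q : X) :
    ∃ z, IsLUB ((fun c : ℝ × ℝ => c.1 • p + c.2 • q) '' K) z := by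
  classical
  set e : X := |p| + |q| with he
  have he0 : 0 ≤ e := add_nonneg (abs_nonneg _) (abs_nonneg _)
  set L : ℝ × ℝ → X := fun c => c.1 • p + c.2 • q with hL
  have hsm : ∀ (t ε : ℝ) (v : X), |t| ≤ ε → t • v ≤ ε • |v| := by
    intro t ε v ht
    have h2 : t • v ≤ |t| • |v| := by
      rcases le_total 0 t with h | h
      · rw [abs_of_nonneg h]
        exact smul_le_smul_of_nonneg_left (le_abs_self v) h
      · rw [abs_of_nonpos h]
        have := smul_le_smul_of_nonneg_left (neg_le_abs v) (neg_nonneg.mpr h)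
        simpa using this
    exact h2.trans (smul_le_smul_of_nonneg_right ht (abs_nonneg v))
  have hnet : ∀ n : ℕ, ∃ F : Finset X, F.Nonempty ∧ (∀ f ∈ F, f ∈ L '' K) ∧
      ∀ s ∈ L '' K, ∃ f ∈ F, s ≤ f + ((1 / 2 : ℝ) ^ n) • e := by
    intro n
    obtain ⟨T, hTK, hTf, hcov⟩ := hK.finite_cover_balls (e := (1 / 2 : ℝ) ^ n) (by positivity)
    refine ⟨hTf.toFinset.image L, ?_, ?_, ?_⟩
    · obtain ⟨c, hc⟩ := hne
      obtain ⟨d, hd, -⟩ := Set.mem_iUnion₂.mp (hcov hc)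
      exact ⟨L d, Finset.mem_image_of_mem _ (by simpa using hd)⟩
    · intro f hf
      obtain ⟨d, hd, rfl⟩ := Finset.mem_image.mp hf
      exact ⟨d, hTK (by simpa using hd), rfl⟩
    · rintro _ ⟨c, hc, rfl⟩
      obtain ⟨d, hd, hcd⟩ := Set.mem_iUnion₂.mp (hcov hc)
      refine ⟨L d, Finset.mem_image_of_mem _ (by simpa using hd), ?_⟩
      rw [Metric.mem_ball, Prod.dist_eq, max_lt_iff, Real.dist_eq, Real.dist_eq] at hcd
      have h1 := hsm _ _ p hcd.1.le
      have h2 := hsm _ _ q hcd.2.le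
      have h3 := add_le_add h1 h2
      rw [← smul_add, ← he] at h3
      have h4 : L c = L d + ((c.1 - d.1) • p + (c.2 - d.2) • q) := by
        simp only [hL, sub_smul]; abel
      rw [h4]
      exact add_le_add_right h3 _
  choose F hFne hFS hFnet using hnet
  set u : ℕ → X := fun n => (F n).sup' (hFne n) id with hu
  have hub : ∀ n, ∀ s ∈ L '' K, s ≤ u n + ((1 / 2 : ℝ) ^ n) • e := by
    intro n s hs
    obtain ⟨f, hf, hsf⟩ := hFnet n s hs
    exact hsf.trans (add_le_add_left (Finset.le_sup' id hf) _)
  have huu : ∀ m n, u m - u n ≤ ((1 / 2 : ℝ) ^ n) • e := by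
    intro m n
    rw [sub_le_iff_le_add']
    exact Finset.sup'_le _ _ fun f hf => hub n f (hFS m f hf)
  have hdist : ∀ n, dist (u n) (u (n + 1)) ≤ ‖e‖ * (1 / 2 : ℝ) ^ n := by
    intro n
    rw [dist_eq_norm]
    have h1 : |u n - u (n + 1)| ≤ |((1 / 2 : ℝ) ^ n) • e| := by
      refine le_trans ?_ (le_abs_self _)
      rw [abs_le']
      refine ⟨(huu n (n + 1)).trans (smul_le_smul_of_nonneg_right ?_ he0), ?_⟩
      · exact pow_le_pow_of_le_one (by norm_num) (by norm_num) (Nat.le_succ n)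
      · rw [neg_sub]
        exact huu (n + 1) n
    have h2 := norm_le_norm_of_abs_le_abs h1
    rw [norm_smul, Real.norm_of_nonneg (by positivity), mul_comm] at h2
    exact h2
  obtain ⟨z, hz⟩ := cauchySeq_tendsto_of_complete
    (cauchySeq_of_le_geometric (1 / 2) ‖e‖ (by norm_num) hdist)
  refine ⟨z, ?_, ?_⟩
  · intro s hs
    have hlim : Filter.Tendsto (fun n => u n + ((1 / 2 : ℝ) ^ n) • e) Filter.atTop (nhds z) := by
      have := hz.add ((tendsto_pow_atTop_nhds_zero_of_lt_one (r := (1 / 2 : ℝ)) (by norm_num)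
        (by norm_num)).smul_const e)
      simpa using this
    exact ge_of_tendsto' hlim fun n => hub n s hs
  · intro b hb
    exact le_of_tendsto' hz fun n => Finset.sup'_le _ _ fun f hf => hb (hFS n f hf)

/-- The element `(|x| ^ r + |y| ^ r) ^ (1 / r)` of a Banach lattice, for `1 < r < ∞`: the least
upper bound of all `a • |x| + b • |y|` with `a, b ≥ 0` and `a ^ r' + b ^ r' ≤ 1`, where
`r' = r / (r - 1)`. -/
noncomputable def lrSum (r : ℝ) (x y : X) : X :=
  lub {z | ∃ a b : ℝ, 0 ≤ a ∧ 0 ≤ b ∧ a ^ (r / (r - 1)) + b ^ (r / (r - 1)) ≤ 1 ∧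
    z = a • |x| + b • |y|}

/-- The least upper bound in the definition of `lrSum` exists. -/
theorem isLUB_lrSum [CompleteSpace X] {r : ℝ} (hr : 1 < r) (x y : X) :
    IsLUB {z | ∃ a b : ℝ, 0 ≤ a ∧ 0 ≤ b ∧ a ^ (r / (r - 1)) + b ^ (r / (r - 1)) ≤ 1 ∧
      z = a • |x| + b • |y|} (lrSum r x y) := by
  refine isLUB_lub ?_
  set q : ℝ := r / (r - 1)
  have hq : 0 < q := div_pos (by linarith) (by linarith)
  set K : Set (ℝ × ℝ) := {c | 0 ≤ c.1 ∧ 0 ≤ c.2 ∧ c.1 ^ q + c.2 ^ q ≤ 1} with hKdef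
  have hclosed : IsClosed K := by
    have hcont : Continuous fun c : ℝ × ℝ => c.1 ^ q + c.2 ^ q :=
      (continuous_fst.rpow_const fun _ => Or.inr hq.le).add
        (continuous_snd.rpow_const fun _ => Or.inr hq.le)
    exact (isClosed_le continuous_const continuous_fst).inter
      ((isClosed_le continuous_const continuous_snd).inter (isClosed_le hcont continuous_const))
  have hone : ∀ a : ℝ, 0 ≤ a → a ^ q ≤ 1 → a ≤ 1 := by
    intro a ha h
    by_contra! hlt
    exact absurd h (not_le.mpr (Real.one_lt_rpow hlt hq))
  have hbox : K ⊆ Set.Icc 0 1 ×ˢ Set.Icc 0 1 := by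
    rintro ⟨a, b⟩ ⟨ha, hb, hab⟩
    simp only at ha hb hab
    have h1 : a ^ q ≤ 1 := by linarith [Real.rpow_nonneg hb q]
    have h2 : b ^ q ≤ 1 := by linarith [Real.rpow_nonneg ha q]
    exact ⟨⟨ha, hone a ha h1⟩,
      ⟨hb, hone b hb h2⟩⟩
  have hcompact : IsCompact K := (isCompact_Icc.prod isCompact_Icc).of_isClosed_subset hclosed hbox
  have hne : K.Nonempty := ⟨(0, 0), le_rfl, le_rfl, by simp [Real.zero_rpow hq.ne']⟩
  obtain ⟨z, hz⟩ := exists_isLUB_image hcompact hne |x| |y|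
  refine ⟨z, ?_⟩
  convert hz using 1
  ext w
  constructor
  · rintro ⟨a, b, ha, hb, hab, rfl⟩
    exact ⟨(a, b), ⟨ha, hb, hab⟩, rfl⟩
  · rintro ⟨⟨a, b⟩, ⟨ha, hb, hab⟩, rfl⟩
    exact ⟨a, b, ha, hb, hab, rfl⟩

end

/-- A Banach lattice is exactly `r`-convex if it is `r`-convex with constant one. -/
def IsExactlyConvex (r : ℝ) (X : Type*) [NormedAddCommGroup X] [Lattice X] [NormedSpace ℝ X] :
    Prop :=
  ∀ x y : X, ‖lrSum r x y‖ ≤ (‖x‖ ^ r + ‖y‖ ^ r) ^ (1 / r)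

/-- The norm of a normed lattice is strictly monotone. -/
def IsStrictlyMonotone (X : Type*) [NormedAddCommGroup X] [Lattice X] : Prop :=
  ∀ x y : X, 0 ≤ x → x < y → ‖x‖ < ‖y‖

/-- The complexification `X + iX` of a real vector space `X`; the pair `(a, b)` is `a + ib`. -/
def Complexification (X : Type*) : Type _ := X × X

namespace Complexification

instance {X : Type*} [AddCommGroup X] : AddCommGroup (Complexification X) :=
  inferInstanceAs (AddCommGroup (X × X))

instance {X : Type*} [AddCommGroup X] [Module ℝ X] : Module ℂ (Complexification X) where
  smul c z := (c.re • z.1 - c.im • z.2, c.re • z.2 + c.im • z.1)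
  one_smul z := by
    refine Prod.ext ?_ ?_
    · change (1 : ℂ).re • z.1 - (1 : ℂ).im • z.2 = z.1
      simp
    · change (1 : ℂ).re • z.2 + (1 : ℂ).im • z.1 = z.2
      simp
  mul_smul c d z := by
    refine Prod.ext ?_ ?_
    · change (c * d).re • z.1 - (c * d).im • z.2 = c.re • (d.re • z.1 - d.im • z.2)
        - c.im • (d.re • z.2 + d.im • z.1)
      rw [Complex.mul_re, Complex.mul_im]
      module
    · change (c * d).re • z.2 + (c * d).im • z.1 = c.re • (d.re • z.2 + d.im • z.1)
        + c.im • (d.re • z.1 - d.im • z.2)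
      rw [Complex.mul_re, Complex.mul_im]
      module
  smul_zero c := by
    refine Prod.ext ?_ ?_
    · change c.re • (0 : X) - c.im • (0 : X) = 0
      simp
    · change c.re • (0 : X) + c.im • (0 : X) = 0
      simp
  smul_add c z w := by
    refine Prod.ext ?_ ?_
    · change c.re • (z.1 + w.1) - c.im • (z.2 + w.2) = (c.re • z.1 - c.im • z.2)
        + (c.re • w.1 - c.im • w.2)
      module
    · change c.re • (z.2 + w.2) + c.im • (z.1 + w.1) = (c.re • z.2 + c.im • z.1)
        + (c.re • w.2 + c.im • w.1)
      module
  add_smul c d z := by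
    refine Prod.ext ?_ ?_
    · change (c + d).re • z.1 - (c + d).im • z.2 = (c.re • z.1 - c.im • z.2)
        + (d.re • z.1 - d.im • z.2)
      rw [Complex.add_re, Complex.add_im]
      module
    · change (c + d).re • z.2 + (c + d).im • z.1 = (c.re • z.2 + c.im • z.1)
        + (d.re • z.2 + d.im • z.1)
      rw [Complex.add_re, Complex.add_im]
      module
  zero_smul z := by
    refine Prod.ext ?_ ?_
    · change (0 : ℂ).re • z.1 - (0 : ℂ).im • z.2 = 0
      simp
    · change (0 : ℂ).re • z.2 + (0 : ℂ).im • z.1 = 0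
      simp

variable {X : Type*} [NormedAddCommGroup X] [Lattice X] [NormedSpace ℝ X]

/-- The modulus `|a + ib|`, the least upper bound of all `(cos θ) a + (sin θ) b`. -/
noncomputable def modulus (z : Complexification X) : X :=
  lub (Set.range fun θ : ℝ => Real.cos θ • z.1 + Real.sin θ • z.2)

/-- The least upper bound in the definition of the modulus exists. -/
theorem isLUB_modulus [IsOrderedAddMonoid X] [HasSolidNorm X] [IsOrderedModule ℝ X]
    [CompleteSpace X] (z : Complexification X) :
    IsLUB (Set.range fun θ : ℝ => Real.cos θ • z.1 + Real.sin θ • z.2) z.modulus := by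
  refine isLUB_lub ?_
  have hper : Function.Periodic (fun θ : ℝ => (Real.cos θ, Real.sin θ)) (2 * Real.pi) := by
    intro θ
    simp
  have hK : IsCompact (Set.range fun θ : ℝ => (Real.cos θ, Real.sin θ)) := by
    rw [← hper.image_Icc (by positivity) 0]
    exact isCompact_Icc.image (Real.continuous_cos.prodMk Real.continuous_sin)
  obtain ⟨w, hw⟩ := exists_isLUB_image hK (Set.range_nonempty _) z.1 z.2
  refine ⟨w, ?_⟩
  rwa [← Set.range_comp] at hw

/-- The norm of the complexification of a Banach lattice: `‖z‖ = ‖ |z| ‖`. -/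
noncomputable instance : Norm (Complexification X) := ⟨fun z => ‖z.modulus‖⟩

end Complexification

end BanachLattice

/-!
For `r ≥ 2` the parallelogram law in `ℂ` and the comparison of power means give
`2 ^ (1 / r) (|x| ^ 2 + |y| ^ 2) ^ (1 / 2) ≤ (|x + y| ^ r + |x - y| ^ r) ^ (1 / r)` in `X`. Hence,
in an exactly `r`-convex lattice, the inequality of the proposition implies
`‖(|x| ^ 2 + t ^ 2 |y| ^ 2) ^ (1 / 2)‖ ^ r ≤ ‖x‖ ^ r + t ^ r ‖y‖ ^ r`. If `|x| ⊓ |y| ≠ 0`, strict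
monotonicity makes the norm on the left exceed `‖x‖` by at least a multiple of `t ^ 2`, which is
impossible for small `t` because `r > 2`. Conversely, moduli of disjoint elements satisfy
`|x| + |y| = |x| ⊔ |y| ≤ (|x| ^ r + |y| ^ r) ^ (1 / r)`. The real case is the complex one restricted
to `X ⊆ X + iX`.
-/

namespace BanachLattice

open Filter Topology

section Scalars

theorem norm_add_rpow_add_norm_sub_rpow_le {E : Type*} [NormedAddCommGroup E]
    [InnerProductSpace ℝ E] {q : ℝ} (hq0 : 0 ≤ q) (hq2 : q ≤ 2) (x y : E) :
    ‖x + y‖ ^ q + ‖x - y‖ ^ q ≤ 2 * (‖x‖ ^ 2 + ‖y‖ ^ 2) ^ (q / 2) := by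
  have rpow_eq (c : ℝ) (hc : 0 ≤ c) : c ^ q = (c ^ 2) ^ (q / 2) := by
    rw [← Real.rpow_natCast_mul hc]
    congr 1
    push_cast
    ring
  have mean_le := (Real.concaveOn_rpow (p := q / 2) (by linarith) (by linarith)).2
    (Set.mem_Ici.mpr (sq_nonneg ‖x + y‖)) (Set.mem_Ici.mpr (sq_nonneg ‖x - y‖))
    (by norm_num : (0 : ℝ) ≤ 1 / 2) (by norm_num : (0 : ℝ) ≤ 1 / 2) (by norm_num)
  have mean_eq : 1 / 2 * ‖x + y‖ ^ 2 + 1 / 2 * ‖x - y‖ ^ 2 = ‖x‖ ^ 2 + ‖y‖ ^ 2 := by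
    linarith [parallelogram_law_with_norm ℝ x y]
  simp only [smul_eq_mul, mean_eq] at mean_le
  rw [rpow_eq _ (norm_nonneg _), rpow_eq _ (norm_nonneg _)]
  linarith

theorem two_rpow_one_div_div_two_rpow {r : ℝ} (hr : 1 < r) :
    ((2 : ℝ) ^ (1 / r) / 2) ^ (r / (r - 1)) = 1 / 2 := by
  have hr0 : r ≠ 0 := by linarith
  have hr1 : r - 1 ≠ 0 := by linarith
  have base_eq : (2 : ℝ) ^ (1 / r) / 2 = 2 ^ (1 / r - 1) := by
    rw [Real.rpow_sub zero_lt_two, Real.rpow_one]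
  have exponent_eq : (1 / r - 1) * (r / (r - 1)) = -1 := by
    field_simp
    ring
  rw [base_eq, ← Real.rpow_mul zero_le_two, exponent_eq, Real.rpow_neg_one, one_div]

theorem eventually_add_rpow_mul_lt_add_sq_mul_rpow {r A δ : ℝ} (hr : 2 < r) (hA : 0 < A)
    (hδ : 0 < δ) (B : ℝ) : ∀ᶠ t in 𝓝[>] (0 : ℝ), A ^ r + t ^ r * B < (A + t ^ 2 * δ) ^ r := by
  set c : ℝ := A ^ r * (r * (δ / A)) with hc
  have hcpos : 0 < c := by positivity
  have tendsto_zero : Tendsto (fun t : ℝ => t ^ (r - 2) * B) (𝓝[>] 0) (𝓝 0) := by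
    have h : ContinuousAt (fun t : ℝ => t ^ (r - 2) * B) 0 :=
      (Real.continuousAt_rpow_const _ _ (Or.inr (by linarith))).mul continuousAt_const
    simpa only [Real.zero_rpow (by linarith : r - 2 ≠ 0), zero_mul] using
      h.tendsto.mono_left nhdsWithin_le_nhds
  filter_upwards [tendsto_zero.eventually_lt_const hcpos, self_mem_nhdsWithin] with t htc ht
  have ht0 : 0 < t := ht
  have bernoulli : 1 + r * (t ^ 2 * (δ / A)) ≤ (1 + t ^ 2 * (δ / A)) ^ r :=
    one_add_mul_self_le_rpow_one_add (by linarith [show 0 ≤ t ^ 2 * (δ / A) by positivity])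
      (by linarith)
  calc A ^ r + t ^ r * B = A ^ r + t ^ 2 * (t ^ (r - 2) * B) := by
        rw [← mul_assoc, ← Real.rpow_natCast t 2, ← Real.rpow_add ht0]
        norm_num
    _ < A ^ r + t ^ 2 * c := by gcongr
    _ = A ^ r * (1 + r * (t ^ 2 * (δ / A))) := by rw [hc]; ring
    _ ≤ A ^ r * (1 + t ^ 2 * (δ / A)) ^ r := by gcongr
    _ = (A + t ^ 2 * δ) ^ r := by
        rw [← Real.mul_rpow hA.le (by positivity)]
        congr 1
        field_simp

end Scalars

section VectorLattice

theorem smul_le_abs_smul_abs {X : Type*} [AddCommGroup X] [Lattice X] [Module ℝ X]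
    [IsOrderedModule ℝ X] (t : ℝ) (x : X) : t • x ≤ |t| • |x| := by
  rcases le_total 0 t with ht | ht
  · rw [abs_of_nonneg ht]
    exact smul_le_smul_of_nonneg_left (le_abs_self x) ht
  · rw [abs_of_nonpos ht, ← neg_smul_neg]
    exact smul_le_smul_of_nonneg_left (neg_le_abs x) (neg_nonneg.mpr ht)

variable {X : Type*} [AddCommGroup X] [Lattice X] [IsOrderedAddMonoid X]

theorem add_eq_sup_of_inf_eq_zero {a b : X} (h : a ⊓ b = 0) : a + b = a ⊔ b := by
  rw [← inf_add_sup a b, h, zero_add]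

variable [Module ℝ X] [IsOrderedModule ℝ X]

theorem inf_smul_eq_zero {a b : X} (h : a ⊓ b = 0) {t : ℝ} (ht : 0 ≤ t) : a ⊓ t • b = 0 := by
  have ha : 0 ≤ a := h ▸ inf_le_left
  have hb : 0 ≤ b := h ▸ inf_le_right
  have hs : 0 < max 1 t := lt_max_of_lt_left one_pos
  refine le_antisymm ?_ (le_inf ha (smul_nonneg ht hb))
  calc a ⊓ t • b ≤ max 1 t • a ⊓ max 1 t • b :=
        inf_le_inf (le_smul_of_one_le_left ha (le_max_left 1 t))
          (smul_le_smul_of_nonneg_right (le_max_right 1 t) hb)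
    _ = max 1 t • (a ⊓ b) := ((OrderIso.smulRight hs).map_inf a b).symm
    _ = 0 := by rw [h, smul_zero]

theorem add_smul_posPart_le {a w m : X} {c : ℝ} (hc : 0 ≤ c) (ha : a ≤ m)
    (haw : a + c • w ≤ m) : a + c • w⁺ ≤ m := by
  rcases hc.eq_or_lt with rfl | hc
  · simpa only [zero_smul, add_zero] using ha
  · rw [← le_sub_iff_add_le', ← le_inv_smul_iff_of_pos hc]
    refine sup_le ?_ (smul_nonneg (inv_nonneg.mpr hc.le) (sub_nonneg.mpr ha))
    rwa [le_inv_smul_iff_of_pos hc, le_sub_iff_add_le']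

end VectorLattice

/-- The inequality of the proposition, as a property of a pair of vectors: an `r`-th power version
of one half of the parallelogram law along the segment from `0` to `y`. It depends only on the norm
and the real linear structure, so isometries preserve it. -/
def IsUpperParallelogramPair {E : Type*} [AddCommGroup E] [Module ℝ E] [Norm E] (r : ℝ)
    (x y : E) : Prop :=
  ∀ t ∈ Set.Icc (0 : ℝ) 1, ‖x + t • y‖ ^ r + ‖x - t • y‖ ^ r ≤ 2 * (‖x‖ ^ r + t ^ r * ‖y‖ ^ r)

theorem isUpperParallelogramPair_map_iff {E F : Type*} [AddCommGroup E] [Module ℝ E] [Norm E]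
    [AddCommGroup F] [Module ℝ F] [Norm F] {T : E →ₗ[ℝ] F} (hT : ∀ z, ‖T z‖ = ‖z‖) {r : ℝ}
    {x y : E} : IsUpperParallelogramPair r (T x) (T y) ↔ IsUpperParallelogramPair r x y := by
  simp only [IsUpperParallelogramPair, ← map_smul, ← map_add, ← map_sub, hT]

theorem norm_le_norm_of_nonneg_of_le {X : Type*} [NormedAddCommGroup X] [Lattice X]
    [IsOrderedAddMonoid X] [HasSolidNorm X] {a b : X} (ha : 0 ≤ a) (hab : a ≤ b) : ‖a‖ ≤ ‖b‖ :=
  norm_le_norm_of_abs_le_abs (by rwa [abs_of_nonneg ha, abs_of_nonneg (ha.trans hab)])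

section NormedLattice

variable {X : Type*} [NormedAddCommGroup X] [NormedSpace ℝ X]

theorem norm_add_mul_le_norm_add_smul (a v : X) {s : ℝ} (hs : 0 ≤ s) :
    ‖a‖ + s * (‖a‖ - ‖a - v‖) ≤ ‖a + s • v‖ := by
  -- `a` is a convex combination of `a + s • v` and `a - v`.
  have triangle := norm_add_le (a + s • v) (s • (a - v))
  rw [show a + s • v + s • (a - v) = (1 + s) • a by module, norm_smul, norm_smul,
    Real.norm_of_nonneg hs, Real.norm_of_nonneg (by linarith)] at triangle
  linarith

variable [Lattice X]

theorem IsExactlyConvex.norm_lrSum_rpow_le {r : ℝ} (hr : 0 < r) (h : IsExactlyConvex r X)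
    (x y : X) : ‖lrSum r x y‖ ^ r ≤ ‖x‖ ^ r + ‖y‖ ^ r := by
  have hxy := h x y
  rwa [one_div, Real.le_rpow_inv_iff_of_pos (norm_nonneg _) (by positivity) hr] at hxy

variable [IsOrderedAddMonoid X] [HasSolidNorm X]

theorem nonpos_of_forall_le_smul {a u : X} (h : ∀ κ ∈ Set.Ioc (0 : ℝ) 1, u ≤ κ • a) : u ≤ 0 := by
  have tendsto_zero : Tendsto (fun κ : ℝ => κ • a) (𝓝[>] 0) (𝓝 0) := by
    have : ContinuousAt (fun κ : ℝ => κ • a) 0 := by fun_prop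
    simpa only [zero_smul] using this.tendsto.mono_left nhdsWithin_le_nhds
  exact ge_of_tendsto tendsto_zero (eventually_of_mem (Ioc_mem_nhdsGT one_pos) h)

variable [IsOrderedModule ℝ X] [CompleteSpace X]

theorem lrSum_le_iff {r : ℝ} (hr : 1 < r) {x y m : X} :
    lrSum r x y ≤ m ↔ ∀ a b : ℝ, 0 ≤ a → 0 ≤ b →
      a ^ (r / (r - 1)) + b ^ (r / (r - 1)) ≤ 1 → a • |x| + b • |y| ≤ m := by
  rw [isLUB_le_iff (isLUB_lrSum hr x y)]
  exact ⟨fun h a b ha hb hab => h ⟨a, b, ha, hb, hab, rfl⟩,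
    fun h _ ⟨a, b, ha, hb, hab, hz⟩ => hz ▸ h a b ha hb hab⟩

theorem abs_sup_abs_le_lrSum {r : ℝ} (hr : 1 < r) (x y : X) : |x| ⊔ |y| ≤ lrSum r x y := by
  have hq : r / (r - 1) ≠ 0 := (div_pos (by linarith) (by linarith)).ne'
  have minorant_le := (lrSum_le_iff hr).mp (le_refl (lrSum r x y))
  refine sup_le ?_ ?_
  · simpa using minorant_le 1 0 zero_le_one le_rfl (by simp [Real.zero_rpow hq])
  · simpa using minorant_le 0 1 le_rfl zero_le_one (by simp [Real.zero_rpow hq])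

theorem IsExactlyConvex.norm_add_rpow_le {r : ℝ} (hr : 1 < r) (h : IsExactlyConvex r X) {x y : X}
    (hxy : |x| ⊓ |y| = 0) : ‖x + y‖ ^ r ≤ ‖x‖ ^ r + ‖y‖ ^ r := by
  have abs_add_le_lrSum : |x + y| ≤ lrSum r x y :=
    calc |x + y| ≤ |x| + |y| := abs_add_le x y
      _ = |x| ⊔ |y| := add_eq_sup_of_inf_eq_zero hxy
      _ ≤ lrSum r x y := abs_sup_abs_le_lrSum hr x y
  calc ‖x + y‖ ^ r ≤ ‖lrSum r x y‖ ^ r :=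
        Real.rpow_le_rpow (norm_nonneg _)
          (norm_le_norm_of_abs_le_abs (abs_add_le_lrSum.trans (le_abs_self _))) (by linarith)
    _ ≤ ‖x‖ ^ r + ‖y‖ ^ r := h.norm_lrSum_rpow_le (by linarith) x y

theorem add_sq_smul_sub_smul_le_lrSum_two {a b : X} (ha : 0 ≤ a) (hb : 0 ≤ b) {t κ : ℝ}
    (ht : t ∈ Set.Icc (0 : ℝ) 1) (hκ : κ ∈ Set.Ioc (0 : ℝ) 1) :
    a + (t ^ 2 * κ) • (b - κ • a) ≤ lrSum 2 a (t • b) := by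
  have hs0 : 0 ≤ t * κ := mul_nonneg ht.1 hκ.1.le
  have hs1 : (t * κ) ^ 2 ≤ 1 := pow_le_one₀ hs0 (mul_le_one₀ ht.2 hκ.1.le hκ.2)
  -- `1 - s ^ 2` minorizes `(1 - s ^ 2) ^ (1 / 2)` for `s = t * κ`.
  have minorant_le := (lrSum_le_iff one_lt_two).mp (le_refl (lrSum 2 a (t • b)))
    (1 - (t * κ) ^ 2) (t * κ) (by linarith) hs0 (by norm_num; nlinarith [sq_nonneg (t * κ)])
  rw [abs_of_nonneg ha, abs_of_nonneg (smul_nonneg ht.1 hb)] at minorant_le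
  exact minorant_le.trans_eq' (by module)

theorem exists_forall_add_sq_smul_le_lrSum_two {a b : X} (ha : 0 ≤ a) (hb : 0 ≤ b)
    (hab : a ⊓ b ≠ 0) :
    ∃ v : X, 0 < v ∧ v ≤ a ∧ ∀ t ∈ Set.Icc (0 : ℝ) 1, a + t ^ 2 • v ≤ lrSum 2 a (t • b) := by
  have hu : 0 ≤ a ⊓ b := le_inf ha hb
  obtain ⟨κ, hκ, hκu⟩ : ∃ κ ∈ Set.Ioc (0 : ℝ) 1, ¬ a ⊓ b ≤ κ • a := by
    by_contra! h
    exact hab ((nonpos_of_forall_le_smul h).antisymm hu)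
  set w := a ⊓ b - κ • a
  have hw_pos : 0 < w⁺ := (posPart_nonneg w).lt_of_ne' fun h =>
    hκu (sub_nonpos.mp (posPart_eq_zero.mp h))
  have hw_le : w⁺ ≤ a ⊓ b := sup_le (sub_le_self _ (smul_nonneg hκ.1.le ha)) hu
  refine ⟨κ • w⁺, (smul_nonneg hκ.1.le hw_pos.le).lt_of_ne' (smul_ne_zero hκ.1.ne' hw_pos.ne'),
    (smul_le_of_le_one_left hw_pos.le hκ.2).trans (hw_le.trans inf_le_left), fun t ht => ?_⟩
  rw [smul_smul]
  refine add_smul_posPart_le (mul_nonneg (sq_nonneg t) hκ.1.le) ?_ ?_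
  · exact (le_abs_self a).trans (le_sup_left.trans (abs_sup_abs_le_lrSum one_lt_two a (t • b)))
  · refine le_trans ?_ (add_sq_smul_sub_smul_le_lrSum_two ha hb ht hκ)
    have hκt : 0 ≤ t ^ 2 * κ := mul_nonneg (sq_nonneg t) hκ.1.le
    gcongr
    exact sub_le_sub_right inf_le_right _

theorem IsStrictlyMonotone.exists_forall_norm_add_sq_mul_le (hmono : IsStrictlyMonotone X)
    {a b : X} (ha : 0 ≤ a) (hb : 0 ≤ b) (hab : a ⊓ b ≠ 0) :
    ∃ δ : ℝ, 0 < δ ∧ ∀ t ∈ Set.Icc (0 : ℝ) 1, ‖a‖ + t ^ 2 * δ ≤ ‖lrSum 2 a (t • b)‖ := by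
  obtain ⟨v, hv0, hva, hv⟩ := exists_forall_add_sq_smul_le_lrSum_two ha hb hab
  refine ⟨‖a‖ - ‖a - v‖, sub_pos.mpr (hmono _ _ (sub_nonneg.mpr hva) (sub_lt_self a hv0)),
    fun t ht => ?_⟩
  calc ‖a‖ + t ^ 2 * (‖a‖ - ‖a - v‖) ≤ ‖a + t ^ 2 • v‖ :=
        norm_add_mul_le_norm_add_smul a v (sq_nonneg t)
    _ ≤ ‖lrSum 2 a (t • b)‖ :=
        norm_le_norm_of_nonneg_of_le (add_nonneg ha (smul_nonneg (sq_nonneg t) hv0.le)) (hv t ht)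

end NormedLattice

namespace Complexification

section VectorSpace

variable {X : Type*} [AddCommGroup X]

theorem add_fst (x y : Complexification X) : (x + y).1 = x.1 + y.1 := rfl

variable [Module ℝ X]

theorem smul_fst (c : ℂ) (z : Complexification X) : (c • z).1 = c.re • z.1 - c.im • z.2 := rfl

/-- The inclusion `a ↦ a + i0` of a real vector space in its complexification. -/
def ofReal : X →ₗ[ℝ] Complexification X where
  toFun x := (x, 0)
  map_add' x y := Prod.ext rfl (add_zero (0 : X)).symm
  map_smul' t x := by
    refine Prod.ext ?_ ?_
    · change t • x = t • x - (0 : ℝ) • (0 : X)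
      simp only [smul_zero, sub_zero]
    · change (0 : X) = t • (0 : X) + (0 : ℝ) • x
      simp only [smul_zero, zero_smul, add_zero]

theorem smul_ofReal_fst (c : ℂ) (x : X) : (c • ofReal x).1 = c.re • x := by
  change c.re • x - c.im • (0 : X) = c.re • x
  rw [smul_zero, sub_zero]

end VectorSpace

variable {X : Type*} [NormedAddCommGroup X] [Lattice X] [NormedSpace ℝ X]

theorem norm_def (z : Complexification X) : ‖z‖ = ‖z.modulus‖ := rfl

variable [IsOrderedAddMonoid X] [HasSolidNorm X] [IsOrderedModule ℝ X] [CompleteSpace X]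

theorem smul_fst_le (c : ℂ) (z : Complexification X) : (c • z).1 ≤ ‖c‖ • z.modulus := by
  have h := smul_le_smul_of_nonneg_left ((isLUB_modulus z).1 ⟨-c.arg, rfl⟩) (norm_nonneg c)
  rwa [smul_add, smul_smul, smul_smul, Real.cos_neg, Real.sin_neg, mul_neg,
    Complex.norm_mul_cos_arg, Complex.norm_mul_sin_arg, neg_smul, ← sub_eq_add_neg] at h

theorem modulus_le_iff {z : Complexification X} {m : X} :
    z.modulus ≤ m ↔ ∀ c : ℂ, ‖c‖ = 1 → (c • z).1 ≤ m := by
  refine ⟨fun h c hc => (smul_fst_le c z).trans (by rwa [hc, one_smul]), fun h => ?_⟩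
  rw [isLUB_le_iff (isLUB_modulus z)]
  rintro _ ⟨θ, rfl⟩
  have hθ := h _ (Complex.norm_exp_ofReal_mul_I (-θ))
  rwa [smul_fst, Complex.exp_ofReal_mul_I_re, Complex.exp_ofReal_mul_I_im, Real.cos_neg,
    Real.sin_neg, neg_smul, sub_neg_eq_add] at hθ

theorem smul_modulus_le {z : Complexification X} {m : X} {s : ℝ} (hs : 0 ≤ s)
    (h : ∀ c : ℂ, ‖c‖ = s → (c • z).1 ≤ m) : s • z.modulus ≤ m := by
  rcases hs.eq_or_lt with rfl | hs
  · have h0 := h 0 norm_zero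
    rw [zero_smul] at h0
    rw [zero_smul]
    exact h0
  rw [← le_inv_smul_iff_of_pos hs, modulus_le_iff]
  intro c hc
  have hsc := h (s * c) (by rw [norm_mul, hc, mul_one, Complex.norm_of_nonneg hs.le])
  rw [le_inv_smul_iff_of_pos hs]
  refine hsc.trans_eq' ?_
  rw [smul_fst, smul_fst, Complex.re_ofReal_mul, Complex.im_ofReal_mul]
  module

theorem smul_modulus_add_smul_modulus_le {x y : Complexification X} {m : X} {s t : ℝ}
    (hs : 0 ≤ s) (ht : 0 ≤ t)
    (h : ∀ c d : ℂ, ‖c‖ = s → ‖d‖ = t → (c • x + d • y).1 ≤ m) :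
    s • x.modulus + t • y.modulus ≤ m := by
  rw [← le_sub_iff_add_le]
  refine smul_modulus_le hs fun c hc => ?_
  rw [le_sub_comm]
  refine smul_modulus_le ht fun d hd => ?_
  rw [le_sub_iff_add_le']
  exact h c d hc hd

theorem abs_fst_le_modulus (z : Complexification X) : |z.1| ≤ z.modulus := by
  have h1 := modulus_le_iff.mp (le_refl z.modulus) 1 norm_one
  have h2 := modulus_le_iff.mp (le_refl z.modulus) (-1) (by rw [norm_neg, norm_one])
  rw [one_smul] at h1
  rw [neg_smul, one_smul] at h2
  exact abs_le'.mpr ⟨h1, h2⟩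

theorem modulus_nonneg (z : Complexification X) : 0 ≤ z.modulus :=
  (abs_nonneg z.1).trans (abs_fst_le_modulus z)

theorem modulus_add_le (x y : Complexification X) :
    (x + y).modulus ≤ x.modulus + y.modulus := by
  refine modulus_le_iff.mpr fun c hc => ?_
  rw [smul_add, add_fst]
  exact add_le_add (modulus_le_iff.mp le_rfl c hc) (modulus_le_iff.mp le_rfl c hc)

theorem modulus_smul (c : ℂ) (z : Complexification X) : (c • z).modulus = ‖c‖ • z.modulus := by
  refine le_antisymm (modulus_le_iff.mpr fun d hd => ?_)
    (smul_modulus_le (norm_nonneg c) fun d hd => ?_)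
  · have h := smul_fst_le (d * c) z
    rwa [mul_smul, norm_mul, hd, one_mul] at h
  · obtain ⟨e, he, rfl⟩ : ∃ e : ℂ, ‖e‖ = 1 ∧ d = e * c := by
      rcases eq_or_ne c 0 with rfl | hc
      · exact ⟨1, norm_one, by simpa using hd⟩
      · exact ⟨d / c, by rw [norm_div, hd, div_self (norm_ne_zero_iff.mpr hc)],
          (div_mul_cancel₀ d hc).symm⟩
    rw [mul_smul]
    exact modulus_le_iff.mp le_rfl e he

protected theorem norm_smul (c : ℂ) (z : Complexification X) : ‖c • z‖ = ‖c‖ * ‖z‖ := by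
  rw [norm_def, norm_def, modulus_smul, norm_smul, norm_norm]

theorem modulus_ofReal (x : X) : (ofReal x).modulus = |x| := by
  refine le_antisymm (modulus_le_iff.mpr fun c hc => ?_) (abs_fst_le_modulus (ofReal x))
  rw [smul_ofReal_fst]
  calc c.re • x ≤ |c.re| • |x| := smul_le_abs_smul_abs c.re x
    _ ≤ |x| := smul_le_of_le_one_left (abs_nonneg x) (hc ▸ Complex.abs_re_le_norm c)

theorem norm_ofReal (x : X) : ‖ofReal x‖ = ‖x‖ := by
  rw [norm_def, modulus_ofReal, norm_abs_eq_norm]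

theorem norm_add_smul_rpow_le_of_disjoint {r : ℝ} (hr : 1 < r) (hX : IsExactlyConvex r X)
    {x y : Complexification X} (h : x.modulus ⊓ y.modulus = 0) (c : ℂ) :
    ‖x + c • y‖ ^ r ≤ ‖x‖ ^ r + ‖c‖ ^ r * ‖y‖ ^ r := by
  have disjoint_moduli : |x.modulus| ⊓ |(c • y).modulus| = 0 := by
    rw [abs_of_nonneg (modulus_nonneg _), abs_of_nonneg (modulus_nonneg _), modulus_smul]
    exact inf_smul_eq_zero h (norm_nonneg c)
  calc ‖x + c • y‖ ^ r ≤ ‖x.modulus + (c • y).modulus‖ ^ r :=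
        Real.rpow_le_rpow (norm_nonneg (x + c • y).modulus)
          (norm_le_norm_of_nonneg_of_le (modulus_nonneg _) (modulus_add_le x (c • y)))
          (by linarith)
    _ ≤ ‖x‖ ^ r + ‖c • y‖ ^ r := hX.norm_add_rpow_le hr disjoint_moduli
    _ = ‖x‖ ^ r + ‖c‖ ^ r * ‖y‖ ^ r := by
        rw [Complexification.norm_smul,
          Real.mul_rpow (y := ‖y‖) (norm_nonneg c) (norm_nonneg y.modulus)]

theorem isUpperParallelogramPair_of_disjoint {r : ℝ} (hr : 1 < r) (hX : IsExactlyConvex r X)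
    {x y : Complexification X} (h : x.modulus ⊓ y.modulus = 0) :
    IsUpperParallelogramPair r x y := by
  intro t ht
  have hadd := norm_add_smul_rpow_le_of_disjoint hr hX h t
  have hsub := norm_add_smul_rpow_le_of_disjoint hr hX h (-t)
  rw [neg_smul, ← sub_eq_add_neg, norm_neg] at hsub
  rw [Complex.norm_of_nonneg ht.1, Complex.coe_smul] at hadd hsub
  linarith

theorem smul_fst_le_lrSum {r : ℝ} (hr : 2 ≤ r) (x y : Complexification X) {c d : ℂ}
    (hcd : ‖c‖ ^ 2 + ‖d‖ ^ 2 ≤ 1) :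
    (2 : ℝ) ^ (1 / r) • (c • x + d • y).1 ≤ lrSum r (x + y).modulus (x - y).modulus := by
  set q := r / (r - 1)
  have hr1 : 0 < r - 1 := by linarith
  have hq0 : 0 ≤ q := by positivity
  have hq2 : q ≤ 2 := (div_le_iff₀ hr1).mpr (by linarith)
  set A : ℝ := (2 : ℝ) ^ (1 / r) / 2 with hA
  have hA0 : 0 ≤ A := by positivity
  have coefficients : (A * ‖c + d‖) ^ q + (A * ‖c - d‖) ^ q ≤ 1 :=
    calc (A * ‖c + d‖) ^ q + (A * ‖c - d‖) ^ q
        = A ^ q * (‖c + d‖ ^ q + ‖c - d‖ ^ q) := by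
          rw [Real.mul_rpow hA0 (norm_nonneg _), Real.mul_rpow hA0 (norm_nonneg _), mul_add]
      _ ≤ A ^ q * (2 * (‖c‖ ^ 2 + ‖d‖ ^ 2) ^ (q / 2)) := by
          gcongr
          exact norm_add_rpow_add_norm_sub_rpow_le hq0 hq2 c d
      _ ≤ A ^ q * (2 * 1) := by
          gcongr
          exact Real.rpow_le_one (by positivity) hcd (by positivity)
      _ = 1 := by
          rw [two_rpow_one_div_div_two_rpow (by linarith)]
          norm_num
  have two_rpow_eq : (2 : ℝ) ^ (1 / r) = 2 * A := by
    rw [hA]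
    ring
  calc (2 : ℝ) ^ (1 / r) • (c • x + d • y).1
      = A • (((c + d) • (x + y)).1 + ((c - d) • (x - y)).1) := by
        rw [← add_fst, show (c + d) • (x + y) + (c - d) • (x - y)
          = (c • x + d • y) + (c • x + d • y) by module,
          add_fst (c • x + d • y) (c • x + d • y), two_rpow_eq]
        module
    _ ≤ A • (‖c + d‖ • (x + y).modulus + ‖c - d‖ • (x - y).modulus) := by
        gcongr <;> exact smul_fst_le _ _
    _ = (A * ‖c + d‖) • |(x + y).modulus| + (A * ‖c - d‖) • |(x - y).modulus| := by
        rw [abs_of_nonneg (modulus_nonneg _), abs_of_nonneg (modulus_nonneg _)]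
        module
    _ ≤ lrSum r (x + y).modulus (x - y).modulus :=
        (lrSum_le_iff (by linarith)).mp le_rfl _ _ (by positivity) (by positivity) coefficients

theorem smul_lrSum_two_modulus_le {r : ℝ} (hr : 2 ≤ r) (x y : Complexification X) :
    (2 : ℝ) ^ (1 / r) • lrSum 2 x.modulus y.modulus ≤
      lrSum r (x + y).modulus (x - y).modulus := by
  have h2 : (0 : ℝ) < 2 ^ (1 / r) := by positivity
  rw [← le_inv_smul_iff_of_pos h2, lrSum_le_iff one_lt_two]
  intro p q hp hq hpq
  rw [abs_of_nonneg (modulus_nonneg _), abs_of_nonneg (modulus_nonneg _)]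
  refine smul_modulus_add_smul_modulus_le hp hq fun c d hc hd => ?_
  rw [le_inv_smul_iff_of_pos h2]
  refine smul_fst_le_lrSum hr x y ?_
  rw [hc, hd]
  norm_num at hpq
  exact hpq

theorem two_mul_norm_lrSum_two_modulus_rpow_le {r : ℝ} (hr : 2 ≤ r) (hX : IsExactlyConvex r X)
    (x y : Complexification X) :
    2 * ‖lrSum 2 x.modulus y.modulus‖ ^ r ≤ ‖x + y‖ ^ r + ‖x - y‖ ^ r := by
  have h2 : (0 : ℝ) ≤ 2 ^ (1 / r) := by positivity
  have lrSum_nonneg : 0 ≤ lrSum 2 x.modulus y.modulus :=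
    (abs_nonneg _).trans (le_sup_left.trans (abs_sup_abs_le_lrSum one_lt_two _ _))
  calc 2 * ‖lrSum 2 x.modulus y.modulus‖ ^ r
      = ‖(2 : ℝ) ^ (1 / r) • lrSum 2 x.modulus y.modulus‖ ^ r := by
        rw [norm_smul, Real.norm_of_nonneg h2, Real.mul_rpow h2 (norm_nonneg _), one_div,
          Real.rpow_inv_rpow zero_le_two (by linarith)]
    _ ≤ ‖lrSum r (x + y).modulus (x - y).modulus‖ ^ r :=
        Real.rpow_le_rpow (norm_nonneg _) (norm_le_norm_of_nonneg_of_le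
          (smul_nonneg h2 lrSum_nonneg) (smul_lrSum_two_modulus_le hr x y)) (by linarith)
    _ ≤ ‖x + y‖ ^ r + ‖x - y‖ ^ r := hX.norm_lrSum_rpow_le (by linarith) _ _

theorem disjoint_of_isUpperParallelogramPair {r : ℝ} (hr : 2 < r) (hmono : IsStrictlyMonotone X)
    (hX : IsExactlyConvex r X) {x y : Complexification X} (h : IsUpperParallelogramPair r x y) :
    x.modulus ⊓ y.modulus = 0 := by
  by_contra hne
  obtain ⟨δ, hδ, growth⟩ :=
    hmono.exists_forall_norm_add_sq_mul_le (modulus_nonneg x) (modulus_nonneg y) hne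
  have hx : 0 < ‖x‖ := norm_pos_iff.mpr fun hx0 : x.modulus = 0 => hne <| by
    rw [hx0, inf_eq_left.mpr (modulus_nonneg y)]
  obtain ⟨t, ht_lt, ht⟩ :=
    ((eventually_add_rpow_mul_lt_add_sq_mul_rpow hr hx hδ (‖y‖ ^ r)).and
      (Ioc_mem_nhdsGT one_pos)).exists
  have hlrSum := two_mul_norm_lrSum_two_modulus_rpow_le hr.le hX x ((t : ℂ) • y)
  rw [modulus_smul, Complex.norm_of_nonneg ht.1.le] at hlrSum
  have hgrowth : (‖x‖ + t ^ 2 * δ) ^ r ≤ ‖lrSum 2 x.modulus (t • y.modulus)‖ ^ r :=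
    Real.rpow_le_rpow (by positivity) (growth t (Set.Ioc_subset_Icc_self ht)) (by linarith)
  have hpair := h t (Set.Ioc_subset_Icc_self ht)
  rw [← Complex.coe_smul] at hpair
  linarith

theorem disjoint_iff_isUpperParallelogramPair {r : ℝ} (hr : 2 < r) (hmono : IsStrictlyMonotone X)
    (hX : IsExactlyConvex r X) {x y : Complexification X} :
    x.modulus ⊓ y.modulus = 0 ↔ IsUpperParallelogramPair r x y :=
  ⟨isUpperParallelogramPair_of_disjoint (by linarith) hX,
    disjoint_of_isUpperParallelogramPair hr hmono hX⟩

end Complexification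

section RealLattice

open Complexification

variable {X : Type*} [NormedAddCommGroup X] [Lattice X] [IsOrderedAddMonoid X] [HasSolidNorm X]
  [NormedSpace ℝ X] [IsOrderedModule ℝ X] [CompleteSpace X]

theorem isUpperParallelogramPair_of_disjoint {r : ℝ} (hr : 1 < r) (hX : IsExactlyConvex r X)
    {x y : X} (h : |x| ⊓ |y| = 0) : IsUpperParallelogramPair r x y := by
  rw [← modulus_ofReal x, ← modulus_ofReal y] at h
  exact (isUpperParallelogramPair_map_iff norm_ofReal).mp
    (Complexification.isUpperParallelogramPair_of_disjoint hr hX h)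

theorem disjoint_iff_isUpperParallelogramPair {r : ℝ} (hr : 2 < r) (hmono : IsStrictlyMonotone X)
    (hX : IsExactlyConvex r X) {x y : X} :
    |x| ⊓ |y| = 0 ↔ IsUpperParallelogramPair r x y := by
  rw [← modulus_ofReal x, ← modulus_ofReal y,
    Complexification.disjoint_iff_isUpperParallelogramPair hr hmono hX,
    isUpperParallelogramPair_map_iff norm_ofReal]

end RealLattice

end BanachLattice

open BanachLattice in
theorem proposition5p2_general (r : ℝ) (hr : 2 < r) :
    (∀ (X : Type*) [NormedAddCommGroup X] [Lattice X] [IsOrderedAddMonoid X] [HasSolidNorm X]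
      [NormedSpace ℝ X] [IsOrderedModule ℝ X] [CompleteSpace X],
      IsStrictlyMonotone X → IsExactlyConvex r X →
        (∀ x y : X, |x| ⊓ |y| = 0 ↔ IsUpperParallelogramPair r x y) ∧
        (∀ x y : Complexification X,
          x.modulus ⊓ y.modulus = 0 ↔ IsUpperParallelogramPair r x y)) ∧
    (∀ (X : Type*) [NormedAddCommGroup X] [Lattice X] [IsOrderedAddMonoid X] [HasSolidNorm X]
      [NormedSpace ℝ X] [IsOrderedModule ℝ X] [CompleteSpace X]
      (Y : Type*) [NormedAddCommGroup Y] [Lattice Y] [IsOrderedAddMonoid Y] [HasSolidNorm Y]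
      [NormedSpace ℝ Y] [IsOrderedModule ℝ Y] [CompleteSpace Y],
      IsExactlyConvex r X → IsExactlyConvex r Y → IsStrictlyMonotone Y →
        (∀ T : X →ₗᵢ[ℝ] Y, ∀ x y : X, |x| ⊓ |y| = 0 → |T x| ⊓ |T y| = 0) ∧
        (∀ T : Complexification X →ₗ[ℝ] Complexification Y, (∀ z, ‖T z‖ = ‖z‖) →
          ∀ x y : Complexification X, x.modulus ⊓ y.modulus = 0 →
            (T x).modulus ⊓ (T y).modulus = 0)) := by
  have hr1 : 1 < r := by linarith
  refine ⟨fun X _ _ _ _ _ _ _ hmono hX => ⟨fun x y => ?_, fun x y => ?_⟩,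
    fun X _ _ _ _ _ _ _ Y _ _ _ _ _ _ _ hX hY hmono =>
      ⟨fun T x y h => ?_, fun T hT x y h => ?_⟩⟩
  · exact disjoint_iff_isUpperParallelogramPair hr hmono hX
  · exact Complexification.disjoint_iff_isUpperParallelogramPair hr hmono hX
  · rw [disjoint_iff_isUpperParallelogramPair hr hmono hY]
    exact (isUpperParallelogramPair_map_iff (T := T.toLinearMap) T.norm_map).mpr
      (isUpperParallelogramPair_of_disjoint hr1 hX h)
  · rw [Complexification.disjoint_iff_isUpperParallelogramPair hr hmono hY]
    exact (isUpperParallelogramPair_map_iff hT).mpr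
      (Complexification.isUpperParallelogramPair_of_disjoint hr1 hX h)

open BanachLattice in
theorem proposition5p2 (r : ℝ) (hr : 2 < r) :
    (∀ (X : Type*) [NormedAddCommGroup X] [Lattice X] [IsOrderedAddMonoid X] [HasSolidNorm X]
      [NormedSpace ℝ X] [IsOrderedModule ℝ X] [CompleteSpace X],
      IsStrictlyMonotone X → IsExactlyConvex r X →
        (∀ x y : X, |x| ⊓ |y| = 0 ↔
          ∀ t ∈ Set.Icc (0 : ℝ) 1,
            ‖x + t • y‖ ^ r + ‖x - t • y‖ ^ r ≤ 2 * (‖x‖ ^ r + t ^ r * ‖y‖ ^ r)) ∧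
        (∀ x y : Complexification X, x.modulus ⊓ y.modulus = 0 ↔
          ∀ t ∈ Set.Icc (0 : ℝ) 1,
            ‖x + (t : ℂ) • y‖ ^ r + ‖x - (t : ℂ) • y‖ ^ r ≤ 2 * (‖x‖ ^ r + t ^ r * ‖y‖ ^ r))) ∧
    (∀ (X : Type*) [NormedAddCommGroup X] [Lattice X] [IsOrderedAddMonoid X] [HasSolidNorm X]
      [NormedSpace ℝ X] [IsOrderedModule ℝ X] [CompleteSpace X]
      (Y : Type*) [NormedAddCommGroup Y] [Lattice Y] [IsOrderedAddMonoid Y] [HasSolidNorm Y]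
      [NormedSpace ℝ Y] [IsOrderedModule ℝ Y] [CompleteSpace Y],
      IsExactlyConvex r X → IsExactlyConvex r Y → IsStrictlyMonotone Y →
        (∀ T : X →ₗᵢ[ℝ] Y, ∀ x y : X, |x| ⊓ |y| = 0 → |T x| ⊓ |T y| = 0) ∧
        (∀ T : Complexification X →ₗ[ℂ] Complexification Y, (∀ z, ‖T z‖ = ‖z‖) →
          ∀ x y : Complexification X, x.modulus ⊓ y.modulus = 0 →
            (T x).modulus ⊓ (T y).modulus = 0)) :=
  (proposition5p2_general r hr).imp_right fun h X _ _ _ _ _ _ _ Y _ _ _ _ _ _ _ hX hY hmono =>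
    (h X Y hX hY hmono).imp_right fun hT T => hT (T.restrictScalars ℝ)
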